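/- Let $\mathbb X=(X_n,n\ge 1)$ be a strictly stationary sequence of real random variables on a probability space $(\Omega,\mathcal F,\mathbb P)$, let $X_{1:n}\le\dots\le X_{n:n}$ be the order statistics of $X_1,\dots,X_n$, and let $a>0$ be fixed. Let $\mathcal I^{\mathbb X}$ be the sigma-field of all sets $A$ for which there is a Borel set $B\subseteq\mathbb R^{\mathbb N}$ with $A=\{\omega:(X_i(\omega),X_{i+1}(\omega),\dots)\in B\}$ for every $i\ge1$. For a random variable $X$ and a sigma-field $\mathcal G\subseteq\mathcal F$, the conditional right endpoint $\gamma_1(X|\mathcal G)$ is the (a.s. unique) $\mathcal G$-measurable $[-\infty,\infty]$-valued $Q$ such that $\mathbb P(X\le Q|\mathcal G)=1$ a.s. and $Q\le Q_1$ a.s. for every $\mathcal G$-measurable $[-\infty,\infty]$-valued $Q_1$ with $\mathbb P(X\le Q_1|\mathcal G)=1$ a.s. For $1\le k\le n$ put $$K(k,n,a)=\sum_{i=1}^n I(X_{k:n}-a<X_i<X_{k:n}),\qquad S(k,n,a)=\sum_{i=1}^n X_i\, I(X_{k:n}-a<X_i<X_{k:n}).$$ Write $u\sim v$ if $u-v=o(v)$,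 that is, for every $\varepsilon>0$ eventually $|u-v|\le\varepsilon|v|$ (so $u=0$ wherever $v=0$, eventually). Theorem 4.3. Let $(k_n,n\ge1)$ be integers with $1\le k_n\le n$ for all $n\ge1$ and $k_n/n\to1$, and suppose that $\gamma_1(X_1|\mathcal I^{\mathbb X})=\infty$ a.s. Then, almost surely, $$\frac{S(k_n,n,a)}{X_{k_n:n}}\sim K(k_n,n,a)\qquad\text{as } n\to\infty.$$ If moreover $(N(t),t\ge0)$ is a process of non-negative integer-valued random variables on $(\Omega,\mathcal F,\mathbb P)$ with $N(t)\to\infty$ a.s. as $t\to\infty$, then, almost surely, $$\frac{S(k_{N(t)},N(t),a)}{X_{k_{N(t)}:N(t)}}\sim K(k_{N(t)},N(t),a)\qquad\text{as } t\to\infty.$$ (Almost surely, the denominators are positive for all large $n$, respectively $t$.) -/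

import Mathlib

open MeasureTheory ProbabilityTheory Filter Topology Asymptotics
open scoped NNReal

namespace NearOrderStat

noncomputable section

/-! A sequence of random variables `X₁, X₂, …` is represented by `X : ℕ → Ω → ℝ`, with `X i` standing
for `X_{i+1}`; the sample of size `n` is therefore `X 0, …, X (n - 1)`. -/

/-- Strict stationarity: for every `h`, the shifted sequence `(X_{1+h}, X_{2+h}, …)` has the same law
on `ℝ^ℕ` as `(X₁, X₂, …)`. -/
def IsStrictlyStationary {Ω : Type*} [MeasurableSpace Ω] (X : ℕ → Ω → ℝ) (μ : Measure Ω) : Prop :=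
  ∀ h : ℕ, IdentDistrib (fun ω (j : ℕ) => X (j + h) ω) (fun ω (j : ℕ) => X j ω) μ μ

/-- The sigma-field of events that are invariant with respect to the sequence `X`: the sets `A` for
which some Borel set `B ⊆ ℝ^ℕ` satisfies `A = {ω : (X_i(ω), X_{i+1}(ω), …) ∈ B}` for every `i`. -/
@[reducible] def invariantSigma {Ω : Type*} (X : ℕ → Ω → ℝ) : MeasurableSpace Ω where
  MeasurableSet' A :=
    ∃ B : Set (ℕ → ℝ), MeasurableSet B ∧ ∀ i : ℕ, A = {ω | (fun j : ℕ => X (i + j) ω) ∈ B}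
  measurableSet_empty := ⟨∅, MeasurableSet.empty, fun _ => by simp⟩
  measurableSet_compl := by
    rintro A ⟨B, hB, h⟩
    refine ⟨Bᶜ, hB.compl, fun i => ?_⟩
    rw [h i]
    rfl
  measurableSet_iUnion := by
    intro f hf
    choose B hB h using hf
    refine ⟨⋃ n, B n, MeasurableSet.iUnion hB, fun i => ?_⟩
    ext ω
    simp only [Set.mem_iUnion, Set.mem_ofPred_eq]
    refine exists_congr fun n => ?_
    rw [h n i]
    rfl

/-- `Q` is (a version of) the conditional right endpoint `γ₁(X|𝒢)` of the support of `X` given the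
sigma-field `𝒢`: the a.s. smallest `𝒢`-measurable extended random variable such that
`P(X ≤ Q | 𝒢) = 1` a.s. -/
structure IsCondRightEndpoint {Ω : Type*} [MeasurableSpace Ω] (μ : Measure Ω)
    (𝒢 : MeasurableSpace Ω) (X : Ω → ℝ) (Q : Ω → EReal) : Prop where
  measurable : Measurable[𝒢] Q
  condProb_eq_one : ∀ᵐ ω ∂μ, (μ⟦{ω' | (X ω' : EReal) ≤ Q ω'} | 𝒢⟧) ω = 1
  ae_le : ∀ Q₁ : Ω → EReal, Measurable[𝒢] Q₁ →
    (∀ᵐ ω ∂μ, (μ⟦{ω' | (X ω' : EReal) ≤ Q₁ ω'} | 𝒢⟧) ω = 1) → ∀ᵐ ω ∂μ, Q ω ≤ Q₁ ω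

/-- The order statistic `x_{k:n}`: the `k`-th entry (`1 ≤ k ≤ n`) of the nondecreasing rearrangement
of the first `n` terms of `x`. The value is `0` when `k` is out of range. -/
def orderStat (x : ℕ → ℝ) (k n : ℕ) : ℝ :=
  if h : 1 ≤ k ∧ k ≤ n then
    x (Tuple.sort (fun i : Fin n => x i) ⟨k - 1, by omega⟩ : Fin n)
  else 0

/-- `K(k, n, a)`: the number of the first `n` terms of `x` lying in `(x_{k:n} - a, x_{k:n})`. -/
def nearCount (x : ℕ → ℝ) (a : ℝ) (k n : ℕ) : ℝ :=
  ∑ i ∈ Finset.range n,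
    (Set.Ioo (orderStat x k n - a) (orderStat x k n)).indicator (fun _ => (1 : ℝ)) (x i)

/-- `S(k, n, a)`: the sum of those of the first `n` terms of `x` lying in
`(x_{k:n} - a, x_{k:n})`. -/
def nearSum (x : ℕ → ℝ) (a : ℝ) (k n : ℕ) : ℝ :=
  ∑ i ∈ Finset.range n,
    x i * (Set.Ioo (orderStat x k n - a) (orderStat x k n)).indicator (fun _ => (1 : ℝ)) (x i)

end

end NearOrderStat

/-! By Garsia's maximal ergodic theorem, if `f` is bounded and nonnegative and `L` is the set of
points along whose orbit the Birkhoff averages of `f` have lower limit zero, then `f` vanishes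
almost everywhere on the invariant set `L`. Apply this to the shift of the stationary sequence and
to the indicator of `{x | M < x 0}`: on the invariant event that the sequence exceeds `M` with lower
frequency zero, `X 0 ≤ M` almost surely. The infinite right endpoint makes this event null, so
almost surely every level is exceeded by a positive proportion of the sample. As `k n / n → 1`, the
order statistics `X_{k n : n}` then tend to infinity, and every observation strictly within `a`
below `X_{k n : n}` has ratio to it within `a / X_{k n : n} → 0` of one. -/

namespace NearOrderStat

section MaximalErgodic

variable {α : Type*} {T : α → α} {f : α → ℝ}

/-- The maximal function `max (S₀ f, …, Sₙ f)` of the Birkhoff sums of `f` along `T`. It is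
nonnegative, as the empty sum `S₀ f = 0` is included. -/
def birkhoffMax (T : α → α) (f : α → ℝ) (n : ℕ) (x : α) : ℝ :=
  partialSups (fun m => birkhoffSum T f m x) n

lemma birkhoffMax_zero (T : α → α) (f : α → ℝ) (x : α) : birkhoffMax T f 0 x = 0 := by
  simp [birkhoffMax]

lemma birkhoffMax_mono (T : α → α) (f : α → ℝ) (x : α) : Monotone fun n => birkhoffMax T f n x :=
  partialSups_monotone _

lemma birkhoffMax_succ (T : α → α) (f : α → ℝ) (n : ℕ) (x : α) :
    birkhoffMax T f (n + 1) x = max 0 (f x + birkhoffMax T f n (T x)) := by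
  have hsucc (n : ℕ) (x : α) :
      birkhoffMax T f (n + 1) x = max (birkhoffMax T f n x) (birkhoffSum T f (n + 1) x) :=
    partialSups_succ _ _
  induction n with
  | zero => simp [hsucc, birkhoffMax_zero]
  | succ n ih =>
    rw [hsucc, ih, hsucc, birkhoffSum_succ', max_assoc, max_add_add_left]

variable [MeasurableSpace α] {ν : Measure α}

lemma integrable_birkhoffMax (hT : MeasurePreserving T ν ν) (hf : Integrable f ν) (n : ℕ) :
    Integrable (birkhoffMax T f n) ν := by
  induction n with
  | zero => simp [funext (birkhoffMax_zero T f)]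
  | succ n ih =>
    rw [funext (birkhoffMax_succ T f n)]
    exact (integrable_zero α ℝ ν).sup (hf.add (hT.integrable_comp_of_integrable ih))

lemma nullMeasurableSet_birkhoffMax_pos (hT : MeasurePreserving T ν ν) (hf : Integrable f ν)
    (n : ℕ) : NullMeasurableSet {x | 0 < birkhoffMax T f n x} ν :=
  nullMeasurableSet_lt aemeasurable_const (integrable_birkhoffMax hT hf n).aemeasurable

theorem setIntegral_birkhoffMax_pos_nonneg (hT : MeasurePreserving T ν ν) (hf : Integrable f ν)
    (n : ℕ) : 0 ≤ ∫ x in {x | 0 < birkhoffMax T f n x}, f x ∂ν := by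
  cases n with
  | zero => simp [birkhoffMax_zero]
  | succ n =>
    have hpos := nullMeasurableSet_birkhoffMax_pos hT hf (n + 1)
    have hM := integrable_birkhoffMax hT hf
    have hMT : Integrable (fun x => birkhoffMax T f n (T x)) ν :=
      hT.integrable_comp_of_integrable (hM n)
    have hinvariant : ∫ x, birkhoffMax T f n (T x) ∂ν = ∫ x, birkhoffMax T f n x ∂ν := by
      rw [← integral_map hT.aemeasurable (hT.map_eq.symm ▸ (hM n).aestronglyMeasurable),
        hT.map_eq]
    have hpointwise (x : α) : birkhoffMax T f (n + 1) x - birkhoffMax T f n (T x) ≤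
        {x | 0 < birkhoffMax T f (n + 1) x}.indicator f x := by
      have hMT_nonneg : 0 ≤ birkhoffMax T f n (T x) :=
        (birkhoffMax_zero T f (T x)).ge.trans (birkhoffMax_mono T f (T x) n.zero_le)
      by_cases hx : 0 < birkhoffMax T f (n + 1) x
      · rw [Set.indicator_of_mem (s := {x | 0 < birkhoffMax T f (n + 1) x}) hx]
        rw [birkhoffMax_succ] at hx ⊢
        rw [max_eq_right (lt_max_iff.1 hx |>.resolve_left (lt_irrefl 0)).le]
        linarith
      · rw [Set.indicator_of_notMem (s := {x | 0 < birkhoffMax T f (n + 1) x}) hx]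
        linarith
    calc
      0 ≤ ∫ x, birkhoffMax T f (n + 1) x ∂ν - ∫ x, birkhoffMax T f n (T x) ∂ν := by
        rw [hinvariant, sub_nonneg]
        exact integral_mono (hM n) (hM (n + 1)) fun x => birkhoffMax_mono T f x n.le_succ
      _ = ∫ x, (birkhoffMax T f (n + 1) x - birkhoffMax T f n (T x)) ∂ν :=
        (integral_sub (hM (n + 1)) hMT).symm
      _ ≤ ∫ x, {x | 0 < birkhoffMax T f (n + 1) x}.indicator f x ∂ν :=
        integral_mono ((hM (n + 1)).sub hMT) (hf.indicator₀ hpos) hpointwise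
      _ = ∫ x in {x | 0 < birkhoffMax T f (n + 1) x}, f x ∂ν := integral_indicator₀ hpos

theorem integral_nonneg_of_ae_exists_birkhoffSum_pos (hT : MeasurePreserving T ν ν)
    (hf : Integrable f ν) (h : ∀ᵐ x ∂ν, ∃ n, 0 < birkhoffSum T f n x) : 0 ≤ ∫ x, f x ∂ν := by
  have hmono : Monotone fun n => {x | 0 < birkhoffMax T f n x} := fun m n hmn x hx =>
    lt_of_lt_of_le hx (birkhoffMax_mono T f x hmn)
  have hcover : ∀ᵐ x ∂ν, x ∈ ⋃ n, {x | 0 < birkhoffMax T f n x} := by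
    filter_upwards [h] with x ⟨n, hn⟩
    exact Set.mem_iUnion.2 ⟨n, hn.trans_le (le_partialSups (fun m => birkhoffSum T f m x) n)⟩
  have hlim := tendsto_setIntegral_of_monotone₀ (nullMeasurableSet_birkhoffMax_pos hT hf) hmono
    hf.integrableOn
  rw [Measure.restrict_eq_self_of_ae_mem hcover] at hlim
  exact ge_of_tendsto' hlim (setIntegral_birkhoffMax_pos_nonneg hT hf)

end MaximalErgodic

section LowerAverage

variable {α : Type*} {T : α → α} {f : α → ℝ}

/-- The points `x` at which the Birkhoff averages of `f` along the orbit of `x` have lower limit at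
most `0`. This is spelled out with `ε` because the real-valued `liminf` takes a junk value on
unbounded sequences. -/
def lowerAverageNonpos (T : α → α) (f : α → ℝ) : Set α :=
  {x | ∀ ε > 0, ∃ᶠ n in atTop, birkhoffAverage ℝ T f n x < ε}

lemma map_mem_lowerAverageNonpos_iff (hf : Bornology.IsBounded (Set.range f)) {x : α} :
    T x ∈ lowerAverageNonpos T f ↔ x ∈ lowerAverageNonpos T f := by
  have hclose {ε : ℝ} (hε : 0 < ε) : ∀ᶠ n in atTop,
      |birkhoffAverage ℝ T f n (T x) - birkhoffAverage ℝ T f n x| < ε := by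
    have hlim := (tendsto_birkhoffAverage_apply_sub_birkhoffAverage' ℝ hf T x).norm
    exact hlim.eventually_lt_const (by simpa using hε)
  constructor <;> intro hx ε hε <;>
    refine ((hx (ε / 2) (half_pos hε)).and_eventually (hclose (half_pos hε))).mono ?_ <;>
    rintro n ⟨hlt, hdist⟩ <;> linarith [abs_lt.1 hdist]

lemma iterate_mem_lowerAverageNonpos_iff (hf : Bornology.IsBounded (Set.range f)) (i : ℕ) {x : α} :
    T^[i] x ∈ lowerAverageNonpos T f ↔ x ∈ lowerAverageNonpos T f := by
  induction i with
  | zero => rfl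
  | succ i ih => rw [Function.iterate_succ_apply', map_mem_lowerAverageNonpos_iff hf, ih]

lemma exists_birkhoffSum_const_sub_pos {x : α} (hx : x ∈ lowerAverageNonpos T f) {ε : ℝ}
    (hε : 0 < ε) : ∃ n, 0 < birkhoffSum T (fun y => ε - f y) n x := by
  obtain ⟨n, hlt, hn⟩ := ((hx ε hε).and_eventually (eventually_gt_atTop 0)).exists
  have hn' : (0 : ℝ) < n := Nat.cast_pos.2 hn
  rw [birkhoffAverage, smul_eq_mul, inv_mul_lt_iff₀ hn'] at hlt
  exact ⟨n, by simpa [birkhoffSum] using hlt⟩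

variable [MeasurableSpace α] {ν : Measure α}

lemma measurable_birkhoffAverage (hT : Measurable T) (hf : Measurable f) (n : ℕ) :
    Measurable (birkhoffAverage ℝ T f n) :=
  (Finset.measurable_fun_sum _ fun i _ => hf.comp (hT.iterate i)).const_smul (n : ℝ)⁻¹

lemma measurableSet_lowerAverageNonpos (hT : Measurable T) (hf : Measurable f) :
    MeasurableSet (lowerAverageNonpos T f) := by
  have heq : lowerAverageNonpos T f =
      ⋂ j : ℕ, limsup (fun n => {x | birkhoffAverage ℝ T f n x < 1 / ((j : ℝ) + 1)}) atTop := by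
    ext x
    simp only [lowerAverageNonpos, Set.mem_iInter, mem_limsup_iff_frequently_mem, Set.mem_ofPred_eq]
    refine ⟨fun hx j => hx _ Nat.one_div_pos_of_nat, fun hx ε hε => ?_⟩
    obtain ⟨j, hj⟩ := exists_nat_one_div_lt hε
    exact (hx j).mono fun n hn => hn.trans hj
  rw [heq]
  exact .iInter fun j => .measurableSet_limsup fun n =>
    measurableSet_lt (measurable_birkhoffAverage hT hf n) measurable_const

lemma integrable_of_isBounded_range [IsFiniteMeasure ν] (hf : Measurable f)
    (hbdd : Bornology.IsBounded (Set.range f)) : Integrable f ν := by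
  obtain ⟨C, hC⟩ := isBounded_iff_forall_norm_le.1 hbdd
  exact .of_bound hf.aestronglyMeasurable C (.of_forall fun x => hC _ ⟨x, rfl⟩)

lemma setIntegral_lowerAverageNonpos_nonpos [IsFiniteMeasure ν] (hT : MeasurePreserving T ν ν)
    (hf : Measurable f) (hbdd : Bornology.IsBounded (Set.range f)) :
    ∫ x in lowerAverageNonpos T f, f x ∂ν ≤ 0 := by
  set L := lowerAverageNonpos T f
  have hL : MeasurableSet L := measurableSet_lowerAverageNonpos hT.measurable hf
  have hTL : MeasurePreserving T (ν.restrict L) (ν.restrict L) := by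
    have hpre : T ⁻¹' L = L := Set.ext fun x => map_mem_lowerAverageNonpos_iff hbdd
    simpa only [hpre] using hT.restrict_preimage hL
  have hint : Integrable f (ν.restrict L) := integrable_of_isBounded_range hf hbdd
  have hle {ε : ℝ} (hε : 0 < ε) : ∫ x in L, f x ∂ν ≤ ν.real L * ε := by
    have hnonneg : 0 ≤ ∫ x in L, (ε - f x) ∂ν :=
      integral_nonneg_of_ae_exists_birkhoffSum_pos hTL ((integrable_const ε).sub hint)
        (ae_restrict_of_forall_mem hL fun x hx => exists_birkhoffSum_const_sub_pos hx hε)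
    rwa [integral_sub (integrable_const ε) hint, setIntegral_const, smul_eq_mul,
      sub_nonneg] at hnonneg
  have hlim : Tendsto (fun ε : ℝ => ν.real L * ε) (𝓝[>] 0) (𝓝 0) := by
    simpa using ((continuous_const_mul (ν.real L)).tendsto 0).mono_left nhdsWithin_le_nhds
  exact ge_of_tendsto hlim (eventually_mem_nhdsWithin.mono fun ε hε => hle hε)

theorem ae_eq_zero_of_mem_lowerAverageNonpos [IsFiniteMeasure ν] (hT : MeasurePreserving T ν ν)
    (hf : Measurable f) (hbdd : Bornology.IsBounded (Set.range f)) (hf_nonneg : 0 ≤ f) :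
    ∀ᵐ x ∂ν, x ∈ lowerAverageNonpos T f → f x = 0 := by
  rw [← ae_restrict_iff' (measurableSet_lowerAverageNonpos hT.measurable hf)]
  exact (integral_eq_zero_iff_of_nonneg hf_nonneg (integrable_of_isBounded_range hf hbdd)).1
    ((setIntegral_lowerAverageNonpos_nonpos hT hf hbdd).antisymm (integral_nonneg hf_nonneg))

end LowerAverage

section Shift

/-- The one-sided shift on real sequences. -/
def shift (x : ℕ → ℝ) : ℕ → ℝ := fun j => x (j + 1)

lemma measurable_shift : Measurable shift :=
  measurable_pi_lambda _ fun j => measurable_pi_apply (j + 1)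

lemma iterate_shift (i : ℕ) (x : ℕ → ℝ) : shift^[i] x = fun j => x (i + j) := by
  induction i generalizing x with
  | zero => simp
  | succ i ih =>
    rw [Function.iterate_succ_apply, ih]
    funext j
    rw [shift, Nat.add_right_comm]

/-- The indicator of the event that the first term of a sequence exceeds `M`; its Birkhoff sums
along the shift count the exceedances of `M`. -/
noncomputable def exceedance (M : ℝ) : (ℕ → ℝ) → ℝ :=
  {x : ℕ → ℝ | M < x 0}.indicator 1

lemma measurable_exceedance (M : ℝ) : Measurable (exceedance M) :=
  measurable_one.indicator (measurableSet_lt measurable_const (measurable_pi_apply 0))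

lemma exceedance_nonneg (M : ℝ) : 0 ≤ exceedance M :=
  fun _ => Set.indicator_nonneg (fun _ _ => zero_le_one) _

lemma isBounded_range_exceedance (M : ℝ) : Bornology.IsBounded (Set.range (exceedance M)) :=
  (Metric.isBounded_Icc 0 1).subset <| Set.range_subset_iff.2 fun x =>
    ⟨exceedance_nonneg M x, Set.indicator_le_self' (fun _ _ => zero_le_one) x⟩

lemma exceedance_eq_zero_iff {M : ℝ} {x : ℕ → ℝ} : exceedance M x = 0 ↔ x 0 ≤ M := by
  simp [exceedance]

lemma birkhoffSum_shift_exceedance (M : ℝ) (n : ℕ) (x : ℕ → ℝ) :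
    birkhoffSum shift (exceedance M) n x = ((Finset.range n).filter fun i => M < x i).card := by
  simp [birkhoffSum, exceedance, iterate_shift, Set.indicator_apply, Finset.sum_boole]

lemma exists_eventually_mul_le_card_of_notMem {M : ℝ} {x : ℕ → ℝ}
    (hx : x ∉ lowerAverageNonpos shift (exceedance M)) :
    ∃ δ : ℝ, 0 < δ ∧
      ∀ᶠ n : ℕ in atTop, δ * n ≤ ((Finset.range n).filter fun i => M < x i).card := by
  simp only [lowerAverageNonpos, Set.mem_ofPred_eq, not_forall, not_frequently, not_lt] at hx
  obtain ⟨δ, hδ, h⟩ := hx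
  refine ⟨δ, hδ, ?_⟩
  filter_upwards [h, eventually_gt_atTop 0] with n hn hpos
  rwa [birkhoffAverage, smul_eq_mul, birkhoffSum_shift_exceedance,
    le_inv_mul_iff₀' (Nat.cast_pos.2 hpos)] at hn

end Shift

section Stationary

lemma measurableSet_invariantSigma_preimage {Ω : Type*} {X : ℕ → Ω → ℝ} {B : Set (ℕ → ℝ)}
    (hB : MeasurableSet B) (hinv : ∀ i x, shift^[i] x ∈ B ↔ x ∈ B) :
    MeasurableSet[invariantSigma X] {ω | (fun j => X j ω) ∈ B} :=
  ⟨B, hB, fun i => Set.ext fun ω => by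
    simpa only [iterate_shift, Set.mem_ofPred_eq] using (hinv i fun j => X j ω).symm⟩

lemma IsCondRightEndpoint.ae_le_of_ae_le_on {Ω : Type*} {𝒢 mΩ : MeasurableSpace Ω}
    {μ : Measure Ω} [IsFiniteMeasure μ] (h𝒢 : 𝒢 ≤ mΩ) {Y : Ω → ℝ} {γ : Ω → EReal}
    (hγ : IsCondRightEndpoint μ 𝒢 Y γ) {A : Set Ω} (hA : MeasurableSet[𝒢] A) {c : EReal}
    (hY : ∀ᵐ ω ∂μ, ω ∈ A → Y ω ≤ c) : ∀ᵐ ω ∂μ, ω ∈ A → γ ω ≤ c := by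
  classical
  let Q : Ω → EReal := A.piecewise (fun _ => c) fun _ => ⊤
  have hQ : Measurable[𝒢] Q :=
    Measurable.piecewise (m := 𝒢) (mβ := inferInstance) hA measurable_const measurable_const
  have hYQ : ({ω | (Y ω : EReal) ≤ Q ω}.indicator fun _ => (1 : ℝ)) =ᵐ[μ] fun _ => 1 := by
    filter_upwards [hY] with ω hω
    refine Set.indicator_of_mem ?_ _
    by_cases hωA : ω ∈ A
    · simpa [Q, hωA] using hω hωA
    · simp [Q, hωA]
  have hcond : ∀ᵐ ω ∂μ, (μ⟦{ω' | (Y ω' : EReal) ≤ Q ω'} | 𝒢⟧) ω = 1 := by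
    have hcongr := condExp_congr_ae (m := 𝒢) hYQ
    rwa [condExp_const h𝒢] at hcongr
  filter_upwards [hγ.ae_le Q hQ hcond] with ω hω hωA
  exact hω.trans_eq (Set.piecewise_eq_of_mem _ _ _ hωA)

variable {Ω : Type*} [MeasurableSpace Ω] {μ : Measure Ω} {X : ℕ → Ω → ℝ}

lemma invariantSigma_le (hX : ∀ i, Measurable (X i)) :
    invariantSigma X ≤ (inferInstance : MeasurableSpace Ω) := by
  rintro A ⟨B, hB, h⟩
  rw [h 0]
  exact measurable_pi_lambda _ (fun j => hX (0 + j)) hB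

lemma IsStrictlyStationary.measurePreserving_shift (hX : ∀ i, Measurable (X i))
    (h : IsStrictlyStationary X μ) :
    MeasurePreserving shift (μ.map fun ω j => X j ω) (μ.map fun ω j => X j ω) := by
  refine ⟨measurable_shift, ?_⟩
  rw [Measure.map_map measurable_shift (measurable_pi_lambda _ hX)]
  exact (h 1).map_eq

lemma ae_notMem_lowerAverageNonpos_exceedance [IsFiniteMeasure μ] (hX : ∀ i, Measurable (X i))
    (hstat : IsStrictlyStationary X μ) {γ : Ω → EReal}
    (hγ : IsCondRightEndpoint μ (invariantSigma X) (X 0) γ) (hγ_top : ∀ᵐ ω ∂μ, γ ω = ⊤) (M : ℝ) :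
    ∀ᵐ ω ∂μ, (fun j => X j ω) ∉ lowerAverageNonpos shift (exceedance M) := by
  have hM := measurable_exceedance M
  have hbdd := isBounded_range_exceedance M
  have hX_le : ∀ᵐ ω ∂μ,
      (fun j => X j ω) ∈ lowerAverageNonpos shift (exceedance M) → (X 0 ω : EReal) ≤ M := by
    have hzero := ae_of_ae_map (measurable_pi_lambda _ hX).aemeasurable <|
      ae_eq_zero_of_mem_lowerAverageNonpos (hstat.measurePreserving_shift hX) hM hbdd
        (exceedance_nonneg M)
    filter_upwards [hzero] with ω hω hmem
    exact EReal.coe_le_coe_iff.2 (exceedance_eq_zero_iff.1 (hω hmem))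
  have hinvariant := measurableSet_invariantSigma_preimage (X := X)
    (measurableSet_lowerAverageNonpos measurable_shift hM)
    fun i _ => iterate_mem_lowerAverageNonpos_iff hbdd i
  filter_upwards [hγ.ae_le_of_ae_le_on (invariantSigma_le hX) hinvariant hX_le, hγ_top]
    with ω hω htop hmem
  exact (hω hmem).not_gt (htop ▸ EReal.coe_lt_top M)

end Stationary

section OrderStat

variable {x : ℕ → ℝ}

lemma lt_orderStat {k n : ℕ} (hk : k ≤ n) {M : ℝ}
    (h : n < k + ((Finset.range n).filter fun i => M < x i).card) : M < orderStat x k n := by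
  have hsplit := Finset.card_filter_add_card_filter_not (s := Finset.range n) fun i => M < x i
  rw [Finset.card_range] at hsplit
  by_contra! hle
  rw [orderStat, dif_pos ⟨by omega, hk⟩] at hle
  set σ := Tuple.sort fun i : Fin n => x i
  have hmono : Monotone ((fun i : Fin n => x i) ∘ σ) := Tuple.monotone_sort _
  have hsmall (i : Fin k) : x (σ (Fin.castLE hk i)) ≤ M :=
    (hmono (Fin.le_def.2 (Nat.le_sub_one_of_lt i.isLt))).trans hle
  have hcard : k ≤ ((Finset.range n).filter fun i => ¬ M < x i).card := by
    simpa using Finset.card_le_card_of_injOn (s := (Finset.univ : Finset (Fin k)))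
      (t := (Finset.range n).filter fun i => ¬ M < x i)
      (fun i => (σ (Fin.castLE hk i) : ℕ)) (fun i _ => by simpa using hsmall i)
      (fun i _ j _ hij => Fin.castLE_injective hk (σ.injective (Fin.ext hij)))
  omega

lemma tendsto_orderStat {k : ℕ → ℕ} (hk : ∀ᶠ n in atTop, k n ≤ n)
    (hk_lim : Tendsto (fun n : ℕ => (k n : ℝ) / (n : ℝ)) atTop (𝓝 1))
    (hx : ∀ M : ℕ, ∃ δ : ℝ, 0 < δ ∧
      ∀ᶠ n : ℕ in atTop, δ * n ≤ ((Finset.range n).filter fun i => (M : ℝ) < x i).card) :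
    Tendsto (fun n => orderStat x (k n) n) atTop atTop := by
  refine tendsto_atTop.2 fun b => ?_
  obtain ⟨M, hM⟩ := exists_nat_ge b
  obtain ⟨δ, hδ, hcount⟩ := hx M
  filter_upwards [hk, hcount, hk_lim.eventually_const_lt (sub_lt_self 1 hδ),
    eventually_gt_atTop 0] with n hkn hcard hratio hn
  rw [lt_div_iff₀ (Nat.cast_pos.2 hn)] at hratio
  have hlt : (n : ℝ) < k n + ((Finset.range n).filter fun i => (M : ℝ) < x i).card := by
    linarith
  exact hM.trans (lt_orderStat hkn (mod_cast hlt)).le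

lemma nearCount_nonneg (x : ℕ → ℝ) (a : ℝ) (k n : ℕ) : 0 ≤ nearCount x a k n :=
  Finset.sum_nonneg fun _ _ => Set.indicator_nonneg (fun _ _ => zero_le_one) _

lemma abs_nearSum_div_orderStat_sub_nearCount_le {a : ℝ} {k n : ℕ} (hpos : 0 < orderStat x k n) :
    |nearSum x a k n / orderStat x k n - nearCount x a k n| ≤
      a / orderStat x k n * nearCount x a k n := by
  unfold nearSum nearCount
  rw [Finset.sum_div, ← Finset.sum_sub_distrib, Finset.mul_sum]
  refine (Finset.abs_sum_le_sum_abs _ _).trans (Finset.sum_le_sum fun i _ => ?_)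
  by_cases hi : x i ∈ Set.Ioo (orderStat x k n - a) (orderStat x k n)
  · rw [Set.indicator_of_mem hi, mul_one, mul_one, div_sub_one hpos.ne', abs_div, abs_of_pos hpos]
    gcongr
    exact abs_le.2 ⟨by linarith [hi.1], by linarith [hi.1, hi.2]⟩
  · simp [Set.indicator_of_notMem hi]

lemma isEquivalent_nearCount {ι : Type*} {l : Filter ι} {k n : ι → ℕ} (a : ℝ)
    (h : Tendsto (fun t => orderStat x (k t) (n t)) l atTop) :
    (fun t => nearSum x a (k t) (n t) / orderStat x (k t) (n t)) ~[l]
      fun t => nearCount x a (k t) (n t) := by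
  refine IsLittleO.of_bound fun c hc => ?_
  filter_upwards [h.eventually_gt_atTop 0, (h.const_div_atTop a).eventually_lt_const hc]
    with t hpos hlt
  have hcount := nearCount_nonneg x a (k t) (n t)
  rw [Pi.sub_apply, Real.norm_eq_abs, Real.norm_of_nonneg hcount]
  exact (abs_nearSum_div_orderStat_sub_nearCount_le hpos).trans (by gcongr)

end OrderStat

theorem ae_tendsto_orderStat {Ω : Type*} [MeasurableSpace Ω] {μ : Measure Ω} [IsFiniteMeasure μ]
    {X : ℕ → Ω → ℝ} (hX : ∀ i, Measurable (X i)) (hstat : IsStrictlyStationary X μ)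
    {γ : Ω → EReal} (hγ : IsCondRightEndpoint μ (invariantSigma X) (X 0) γ)
    (hγ_top : ∀ᵐ ω ∂μ, γ ω = ⊤) {k : ℕ → ℕ} (hk : ∀ᶠ n in atTop, k n ≤ n)
    (hk_lim : Tendsto (fun n : ℕ => (k n : ℝ) / (n : ℝ)) atTop (𝓝 1)) :
    ∀ᵐ ω ∂μ, Tendsto (fun n => orderStat (fun i => X i ω) (k n) n) atTop atTop := by
  filter_upwards [ae_all_iff.2 fun M : ℕ =>
    ae_notMem_lowerAverageNonpos_exceedance hX hstat hγ hγ_top M] with ω hω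
  exact tendsto_orderStat hk hk_lim fun M => exists_eventually_mul_le_card_of_notMem (hω M)

end NearOrderStat

theorem theorem4p3_general {Ω : Type*} [MeasurableSpace Ω] {μ : Measure Ω} [IsFiniteMeasure μ]
    {X : ℕ → Ω → ℝ} (hX : ∀ i, Measurable (X i))
    (hstat : NearOrderStat.IsStrictlyStationary X μ)
    {γ : Ω → EReal}
    (hγ : NearOrderStat.IsCondRightEndpoint μ (NearOrderStat.invariantSigma X) (X 0) γ)
    (hγ_top : ∀ᵐ ω ∂μ, γ ω = ⊤) (a : ℝ)
    {k : ℕ → ℕ} (hk : ∀ᶠ n in atTop, k n ≤ n)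
    (hk_lim : Tendsto (fun n : ℕ => (k n : ℝ) / (n : ℝ)) atTop (𝓝 1))
    {ι : Type*} {l : Filter ι} {N : ι → Ω → ℕ}
    (hN : ∀ᵐ ω ∂μ, Tendsto (fun t => N t ω) l atTop) :
    ∀ᵐ ω ∂μ,
      (fun t => NearOrderStat.nearSum (fun i => X i ω) a (k (N t ω)) (N t ω) /
          NearOrderStat.orderStat (fun i => X i ω) (k (N t ω)) (N t ω))
        ~[l] (fun t => NearOrderStat.nearCount (fun i => X i ω) a (k (N t ω)) (N t ω)) := by
  filter_upwards [NearOrderStat.ae_tendsto_orderStat hX hstat hγ hγ_top hk hk_lim, hN]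
    with ω hω hNω
  exact NearOrderStat.isEquivalent_nearCount a (hω.comp hNω)

theorem theorem4p3 {Ω : Type*} [MeasurableSpace Ω] (μ : Measure Ω) [IsProbabilityMeasure μ]
    (X : ℕ → Ω → ℝ) (hX : ∀ i, Measurable (X i))
    (hstat : NearOrderStat.IsStrictlyStationary X μ)
    (γ : Ω → EReal)
    (hγ : NearOrderStat.IsCondRightEndpoint μ (NearOrderStat.invariantSigma X) (X 0) γ)
    (hγ_top : ∀ᵐ ω ∂μ, γ ω = ⊤)
    (a : ℝ) (ha : 0 < a)
    (k : ℕ → ℕ) (hk : ∀ n, 1 ≤ n → 1 ≤ k n ∧ k n ≤ n)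
    (hk_lim : Tendsto (fun n : ℕ => (k n : ℝ) / (n : ℝ)) atTop (𝓝 1)) :
    (∀ᵐ ω ∂μ,
      (fun n : ℕ => NearOrderStat.nearSum (fun i => X i ω) a (k n) n /
          NearOrderStat.orderStat (fun i => X i ω) (k n) n)
        ~[atTop] (fun n : ℕ => NearOrderStat.nearCount (fun i => X i ω) a (k n) n)) ∧
    (∀ N : ℝ≥0 → Ω → ℕ, (∀ t, Measurable (N t)) →
      (∀ᵐ ω ∂μ, Tendsto (fun t : ℝ≥0 => N t ω) atTop atTop) →
      ∀ᵐ ω ∂μ,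
        (fun t : ℝ≥0 => NearOrderStat.nearSum (fun i => X i ω) a (k (N t ω)) (N t ω) /
            NearOrderStat.orderStat (fun i => X i ω) (k (N t ω)) (N t ω))
          ~[atTop]
        (fun t : ℝ≥0 => NearOrderStat.nearCount (fun i => X i ω) a (k (N t ω)) (N t ω))) :=
  have hk_le : ∀ᶠ n in atTop, k n ≤ n := (eventually_ge_atTop 1).mono fun n hn => (hk n hn).2
  ⟨theorem4p3_general hX hstat hγ hγ_top a hk_le hk_lim (.of_forall fun _ => tendsto_id),
    fun _ _ hN => theorem4p3_general hX hstat hγ hγ_top a hk_le hk_lim hN⟩
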